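/- Let $L^\infty([1,\infty))$ be the Banach space of real-valued essentially bounded measurable functions on $[1,\infty)$. A mean on it is a positive linear functional $\psi$ with $\psi(1)=1$. For $f\in L^\infty([1,\infty))$ put $$\overline{L}_1(f)=\lim_{\theta\to\infty}\limsup_{x\to\infty}\frac{1}{\log\theta}\int_x^{\theta x}f(t)\frac{dt}{t},$$ and let $\mathcal{L}_1$ be the set of means $\psi$ with $\psi(f)\le\overline{L}_1(f)$ for every $f\in L^\infty([1,\infty))$. Let $\Omega^*$ be the set of ultrafilters on $[0,\infty)$ of the form $\{t+A:A\in\eta\}$, with $\eta$ a free ultrafilter on $\mathbb{N}_0=\{0,1,2,\dots\}$ and $t\in[0,1]$. For an ultrafilter $\mathcal{V}$ on $[0,\infty)$ or on $[1,\infty)$ let $e^{\mathcal{V}}$ be the ultrafilter on $[1,\infty)$ generated by the sets $e^A=\{e^x:x\in A\}$, $A\in\mathcal{V}$. For $\omega\in\Omega^*$ and $f\in L^\infty([1,\infty))$ let $f^\times_\omega\in L^\infty([1,\infty))$ be the limit of the dilates $x\mapsto f(rx)$ ($r\ge1$) along $r\to e^\omega$ in the weak* topology of $L^\infty([1,\infty))=L^1([1,\infty))^*$.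 For $\omega\in\Omega^*$ and an ultrafilter $\mathcal{U}$ on $[1,\infty)$ containing no bounded set, put $$\psi^{\mathcal{U}}_\omega(f)=e^{\mathcal{U}}\text{-}\lim_x\frac{1}{\log x}\int_1^x f^\times_\omega(t)\frac{dt}{t},\qquad f\in L^\infty([1,\infty)),$$ and let $\mathcal{P}$ be the set of all functionals $\psi^{\mathcal{U}}_\omega$. Theorem 4.9. These objects are well defined: the limit over $\theta$ defining $\overline{L}_1(f)$ exists for every $f$, the weak* limit $f^\times_\omega$ exists and is unique for every $\omega\in\Omega^*$ and every $f$, and for every $\omega\in\Omega^*$ and every $\mathcal{U}$ as above, $\psi^{\mathcal{U}}_\omega$ exists and is a continuous linear functional on $L^\infty([1,\infty))$. Moreover $$\mathcal{L}_1=\overline{co}(\mathcal{P}),$$ where $\overline{co}(\mathcal{P})$ is the closed convex hull of $\mathcal{P}$ in the weak* topology of the dual space $L^\infty([1,\infty))^*$. -/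

import Mathlib

open Filter Topology MeasureTheory Set
open scoped ENNReal

noncomputable section

namespace LogMeans

/-- The space `L^∞([1, ∞))` of real-valued essentially bounded measurable functions on
`[1, ∞)`, modulo equality almost everywhere. -/
abbrev Linf : Type := Lp ℝ ∞ (volume.restrict (Ici (1 : ℝ)))

/-- The constant function `1` as an element of `L^∞([1, ∞))`. -/
def oneLinf : Linf := (memLp_top_const (1 : ℝ)).toLp (fun _ : ℝ => (1 : ℝ))

/-- A mean: a normalized positive linear functional on `L^∞([1, ∞))`. Such functionals are
automatically continuous, so they are taken in the dual space; `WeakDual` is the dual space with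
its weak* topology. -/
def IsMean (ψ : WeakDual ℝ Linf) : Prop :=
  (∀ f : Linf, 0 ≤ f → 0 ≤ ψ f) ∧ ψ oneLinf = 1

/-- `limsup_{x → ∞} (1 / log θ) ∫_x^{θ x} f(t) dt / t`. -/
def upperLogAverage (f : Linf) (θ : ℝ) : ℝ :=
  limsup (fun x : ℝ => (1 / Real.log θ) * ∫ t in x..(θ * x), f t / t) atTop

/-- `lim_{θ → ∞} limsup_{x → ∞} (1 / log θ) ∫_x^{θ x} f(t) dt / t`. -/
def upperLogMean (f : Linf) : ℝ := limUnder atTop (upperLogAverage f)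

/-- The class of means dominated by `upperLogMean`. -/
def L1 : Set (WeakDual ℝ Linf) :=
  {ψ | IsMean ψ ∧ ∀ f : Linf, ψ f ≤ upperLogMean f}

/-- The points `(η, t)` of `Ω* = Ω \ [0, ∞)`, where `Ω` is `βℕ × [0, 1]` with `(η, 1)` and
`(τ η, 0)` glued together: the ultrafilters `{t + A : A ∈ η}` with `η` a free ultrafilter on `ℕ`
and `t ∈ [0, 1]`. -/
def OmegaStar : Set (Ultrafilter ℝ) :=
  {ω | ∃ η : Ultrafilter ℕ, (∀ n : ℕ, η ≠ pure n) ∧ ∃ t ∈ Icc (0 : ℝ) 1,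
    ω = η.map (fun n : ℕ => (n : ℝ) + t)}

/-- The ultrafilters on `[1, ∞)` which contain no bounded set. -/
def UnboundedUltrafilters : Set (Ultrafilter ℝ) :=
  {𝒰 | Ici (1 : ℝ) ∈ 𝒰 ∧ ∀ A ∈ 𝒰, ¬ Bornology.IsBounded A}

/-- `g` is the limit of the dilates `x ↦ f (r x)`, `r ≥ 1`, along the ultrafilter
`e^ω = {e^A : A ∈ ω}` in the weak* topology of `L^∞([1, ∞))` as the dual of `L^1([1, ∞))`. -/
def IsDilateLimit (ω : Ultrafilter ℝ) (f g : Linf) : Prop :=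
  ∀ h : ℝ → ℝ, IntegrableOn h (Ici 1) →
    Tendsto (fun r : ℝ => ∫ x in Ici (1 : ℝ), f (r * x) * h x) (ω.map Real.exp)
      (𝓝 (∫ x in Ici (1 : ℝ), g x * h x))

/-- `ψ` is the functional `f ↦ e^𝒰-lim_x (1 / log x) ∫_1^x g(t) dt / t`, where `g` is the
weak* limit of the dilates of `f` along `e^ω`. -/
def IsPsi (ω 𝒰 : Ultrafilter ℝ) (ψ : WeakDual ℝ Linf) : Prop :=
  ∀ f : Linf, ∃ g : Linf, IsDilateLimit ω f g ∧
    Tendsto (fun x : ℝ => (1 / Real.log x) * ∫ t in (1 : ℝ)..x, g t / t) (𝒰.map Real.exp)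
      (𝓝 (ψ f))

/-- The set of all the functionals `ψ_ω^𝒰`. -/
def P : Set (WeakDual ℝ Linf) :=
  {ψ | ∃ ω ∈ OmegaStar, ∃ 𝒰 ∈ UnboundedUltrafilters, IsPsi ω 𝒰 ψ}

end LogMeans

end

namespace LogMeans

open scoped NNReal Interval

/-! In the variable `u = log t` the measure `dt / t` becomes `du`, and `f` is replaced by its
primitive `Φ = logPrim f`, a Lipschitz function. Then `upperLogAverage f (exp a)` is `shiftSup Φ a /
a`, and `shiftSup Φ` is subadditive, so Fekete's lemma gives the limit `L = upperLogMean f`.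

Dilates of `f` are bounded in `L^∞`, so they have a weak* limit `g` along `e^ω`. Testing against
`1/x` on `(1, e^X]` gives `logPrim g X = ω-lim_u (Φ (u + X) - Φ u)`
(`IsDilateLimit.tendsto_logPrim`). This is at most `shiftSup Φ X`; dividing by `X` and passing to
the limit along `𝒰` puts `ψ_ω^𝒰` in `L1`, which is convex and weak* closed.

Conversely, weak* continuous functionals on the dual are evaluations at points `f`. By Hahn–Banach
it is enough that for each `f` some element of `P` has value at least `L` at `f`
(`exists_mem_P_upperLogMean_le`). Its source is `exists_nat_forall_increment_ge`: far out there are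
integers from which all average increments up to a prescribed length are nearly `L`. An `ω`
concentrated on such integers gives `logPrim g k ≥ L * k` for all `k`. -/

/-- The limsup of the increments of length `a` of a function on the line. -/
noncomputable def shiftSup (Φ : ℝ → ℝ) (a : ℝ) : ℝ := limsup (fun u => Φ (u + a) - Φ u) atTop

/-! ### Increments of Lipschitz functions and Fekete's lemma. -/

section Increments

variable {Φ : ℝ → ℝ} {C : ℝ≥0}

theorem abs_increment_le (h : LipschitzWith C Φ) (u a : ℝ) : |Φ (u + a) - Φ u| ≤ C * |a| := by
  have := h.dist_le_mul (u + a) u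
  simpa [Real.dist_eq] using this

theorem increment_isBoundedUnder (h : LipschitzWith C Φ) (l : Filter ℝ) (a : ℝ) :
    l.IsBoundedUnder (· ≤ ·) (fun u => Φ (u + a) - Φ u) :=
  isBoundedUnder_of ⟨C * |a|, fun u => (abs_le.1 (abs_increment_le h u a)).2⟩

theorem increment_isBoundedUnder_ge (h : LipschitzWith C Φ) (l : Filter ℝ) (a : ℝ) :
    l.IsBoundedUnder (· ≥ ·) (fun u => Φ (u + a) - Φ u) :=
  isBoundedUnder_of ⟨-(C * |a|), fun u => (abs_le.1 (abs_increment_le h u a)).1⟩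

theorem shiftSup_le (h : LipschitzWith C Φ) {a b : ℝ}
    (hb : ∀ᶠ u in atTop, Φ (u + a) - Φ u ≤ b) : shiftSup Φ a ≤ b :=
  limsup_le_of_le (increment_isBoundedUnder_ge h _ a).isCoboundedUnder_flip hb

theorem eventually_increment_lt (h : LipschitzWith C Φ) {a b : ℝ} (hb : shiftSup Φ a < b) :
    ∀ᶠ u in atTop, Φ (u + a) - Φ u < b :=
  eventually_lt_of_limsup_lt hb (increment_isBoundedUnder h _ a)

theorem neg_le_shiftSup (h : LipschitzWith C Φ) (a : ℝ) : -(C * |a|) ≤ shiftSup Φ a :=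
  le_limsup_of_frequently_le
    (Eventually.of_forall fun u => (abs_le.1 (abs_increment_le h u a)).1).frequently
    (increment_isBoundedUnder h _ a)

/-- An increment of length `a + b` at `u` is one of length `a` at `u` plus one of length `b` at `u +
a`, and `u + a` tends to infinity with `u`. -/
theorem shiftSup_add_le (h : LipschitzWith C Φ) (a b : ℝ) :
    shiftSup Φ (a + b) ≤ shiftSup Φ a + shiftSup Φ b := by
  refine le_of_forall_pos_le_add fun ε hε => shiftSup_le h ?_
  have h1 := eventually_increment_lt h (show shiftSup Φ a < shiftSup Φ a + ε / 2 by linarith)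
  have h2 := eventually_increment_lt h (show shiftSup Φ b < shiftSup Φ b + ε / 2 by linarith)
  have h3 := (tendsto_atTop_add_const_right atTop a tendsto_id).eventually h2
  filter_upwards [h1, h3] with u hu hv
  simp only [id] at hv
  rw [← add_assoc]
  linarith

theorem shiftSup_le_add (h : LipschitzWith C Φ) (a b : ℝ) :
    shiftSup Φ a ≤ shiftSup Φ b + C * |a - b| := by
  refine le_of_forall_pos_le_add fun ε hε => shiftSup_le h ?_
  filter_upwards [eventually_increment_lt h (show shiftSup Φ b < shiftSup Φ b + ε by linarith)]
    with u hu
  have := (abs_le.1 (abs_increment_le h (u + b) (a - b))).2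
  rw [show u + b + (a - b) = u + a by ring] at this
  linarith

/-- Fekete's lemma for the subadditive function `shiftSup Φ` of a real variable. -/
theorem exists_tendsto_shiftSup_div (h : LipschitzWith C Φ) :
    ∃ L, Tendsto (fun a => shiftSup Φ a / a) atTop (𝓝 L) := by
  have hs : Subadditive fun n : ℕ => shiftSup Φ n := fun m n => by
    push_cast; exact shiftSup_add_le h m n
  have hbdd : BddBelow (range fun n : ℕ => shiftSup Φ n / n) := by
    refine ⟨-C, ?_⟩
    rintro _ ⟨n, rfl⟩
    rcases Nat.eq_zero_or_pos n with rfl | hn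
    -- At `n = 0` the quotient is `0` by the convention for division by zero.
    · simp
    · have hn' : (0 : ℝ) < n := by exact_mod_cast hn
      have := neg_le_shiftSup h n
      rw [abs_of_pos hn'] at this
      dsimp only
      rw [le_div_iff₀ hn']
      linarith
  refine ⟨hs.lim, ?_⟩
  have h1 := (hs.tendsto_lim hbdd).comp (tendsto_nat_floor_atTop (α := ℝ))
  have h2 := h1.mul (tendsto_nat_floor_div_atTop (R := ℝ))
  rw [mul_one] at h2
  -- Since `shiftSup Φ` is Lipschitz, rounding `a` down in the numerator changes the quotient by at
  -- most `C / a`.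
  have h3 : Tendsto (fun a : ℝ => shiftSup Φ a / a - shiftSup Φ ⌊a⌋₊ / a) atTop (𝓝 0) := by
    refine squeeze_zero_norm' ?_ (tendsto_const_nhds (x := (C : ℝ)).div_atTop tendsto_id)
    filter_upwards [eventually_ge_atTop 1] with a ha
    have ha0 : 0 < a := by linarith
    have hf1 := Nat.floor_le ha0.le
    have hf2 := Nat.lt_floor_add_one a
    have hd : |a - ⌊a⌋₊| ≤ 1 := abs_le.2 ⟨by linarith, by linarith⟩
    have hd' : |(⌊a⌋₊ : ℝ) - a| ≤ 1 := by rwa [abs_sub_comm]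
    rw [← sub_div, norm_div, Real.norm_eq_abs, Real.norm_eq_abs, abs_of_pos ha0, id]
    gcongr
    have i1 := shiftSup_le_add h a ⌊a⌋₊
    have i2 := shiftSup_le_add h ⌊a⌋₊ a
    have i3 := mul_le_mul_of_nonneg_left hd C.2
    have i4 := mul_le_mul_of_nonneg_left hd' C.2
    simp only [NNReal.val_eq_coe] at i3 i4
    exact abs_le.2 ⟨by linarith, by linarith⟩
  have h4 := h2.add h3
  rw [add_zero] at h4
  refine h4.congr' ?_
  filter_upwards [eventually_ge_atTop 1] with a ha
  have : (⌊a⌋₊ : ℝ) ≠ 0 := by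
    have := Nat.one_le_floor_iff a |>.2 ha
    positivity
  simp only [Function.comp]
  field_simp
  ring

/-- There are arbitrarily large integers from which all the average increments up to a given
length almost reach the limit of `shiftSup Φ a / a`. -/
theorem exists_nat_forall_increment_ge (h : LipschitzWith C Φ) {L : ℝ}
    (hL : Tendsto (fun a => shiftSup Φ a / a) atTop (𝓝 L)) {ε : ℝ} (hε : 0 < ε) (H R : ℕ) :
    ∃ n : ℕ, R ≤ n ∧ ∀ k : ℕ, 1 ≤ k → k ≤ H → (L - ε) * k ≤ Φ (n + k) - Φ n := by
  by_contra! hcon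
  set b := L - ε with hb
  -- By contradiction, every `n ≥ R` starts a block of length at most `H` with average increment
  -- below `b`. Chaining blocks covers `[n, n + l]` up to a remainder shorter than `H`, which costs
  -- at most `(C + |b|) * H`.
  have key : ∀ l n : ℕ, R ≤ n → Φ (n + l) - Φ n ≤ b * l + (C + |b|) * H := by
    intro l
    induction l using Nat.strong_induction_on with
    | _ l ih =>
      intro n hn
      rcases lt_or_ge l H with hl | hl
      · have i1 := (abs_le.1 (abs_increment_le h n l)).2
        rw [Nat.abs_cast] at i1
        have hl' : (l : ℝ) ≤ H := by exact_mod_cast hl.le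
        have i2 := mul_le_mul_of_nonneg_left hl' C.2
        have i3 := mul_le_mul_of_nonneg_left hl' (abs_nonneg b)
        have i4 := mul_le_mul_of_nonneg_right (neg_abs_le b) (Nat.cast_nonneg (α := ℝ) l)
        simp only [NNReal.val_eq_coe] at i2
        linarith
      · obtain ⟨k, hk1, hk2, hk⟩ := hcon n hn
        have := ih (l - k) (by omega) (n + k) (by omega)
        rw [Nat.cast_sub (hk2.trans hl)] at this
        push_cast at this
        rw [show (n : ℝ) + k + (l - k) = n + l by ring] at this
        linarith
  -- The extra `2 * C` pays for moving both endpoints from a real `u` to its integer part. Dividing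
  -- the next bound by `l` yields `L ≤ b = L - ε`.
  set K := (C + |b|) * H + 2 * C with hK
  have hup : ∀ l : ℕ, shiftSup Φ l ≤ b * l + K := by
    intro l
    refine shiftSup_le h ?_
    filter_upwards [eventually_ge_atTop (R + 1 : ℝ)] with u hu
    have hu0 : 0 ≤ u := by have := Nat.cast_nonneg (α := ℝ) R; linarith
    have hf1 := Nat.floor_le hu0
    have hf2 := Nat.lt_floor_add_one u
    have hR : R ≤ ⌊u⌋₊ := Nat.le_floor (by linarith)
    have hd : |u - ⌊u⌋₊| ≤ 1 := abs_le.2 ⟨by linarith, by linarith⟩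
    have i0 := key l _ hR
    have i1 := (abs_le.1 (abs_increment_le h ⌊u⌋₊ (u - ⌊u⌋₊))).1
    have i2 := (abs_le.1 (abs_increment_le h (⌊u⌋₊ + l) (u - ⌊u⌋₊))).2
    have i3 := mul_le_mul_of_nonneg_left hd C.2
    simp only [NNReal.val_eq_coe] at i3
    rw [add_sub_cancel] at i1
    rw [show (⌊u⌋₊ : ℝ) + l + (u - ⌊u⌋₊) = u + l by ring] at i2
    linarith
  have hlim : Tendsto (fun l : ℕ => b + K / (l : ℝ)) atTop (𝓝 (b + 0)) :=
    tendsto_const_nhds.add (tendsto_const_nhds.div_atTop tendsto_natCast_atTop_atTop)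
  have := le_of_tendsto_of_tendsto (hL.comp tendsto_natCast_atTop_atTop) hlim (by
    filter_upwards [eventually_ge_atTop 1] with l hl
    have hl0 : (0 : ℝ) < l := by exact_mod_cast hl
    simp only [Function.comp]
    rw [div_le_iff₀ hl0, add_mul, div_mul_cancel₀ _ hl0.ne']
    exact hup l)
  linarith

end Increments

/-! ### Weak* limits of bounded families, deduced from the self-duality of `L²`. -/

section WeakStar

variable {α ι : Type*} [MeasurableSpace α] {μ : Measure α}

theorem integrable_bdd_mul {F h : α → ℝ} {C : ℝ} (hF : AEStronglyMeasurable F μ)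
    (hb : ∀ᵐ x ∂μ, |F x| ≤ C) (hh : Integrable h μ) : Integrable (fun x => F x * h x) μ :=
  hh.bdd_mul hF hb

theorem abs_integral_mul_le {F h : α → ℝ} {C : ℝ}
    (hb : ∀ᵐ x ∂μ, |F x| ≤ C) (hh : Integrable h μ) :
    |∫ x, F x * h x ∂μ| ≤ C * ∫ x, |h x| ∂μ := by
  rw [← integral_const_mul]
  refine norm_integral_le_of_norm_le (f := fun x => F x * h x) (hh.abs.const_mul C) ?_
  filter_upwards [hb] with x hx
  rw [Real.norm_eq_abs, abs_mul]
  gcongr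

/-- A bounded family in `L²` has weak limits along ultrafilters. -/
theorem exists_weak_limit_L2 (l : Ultrafilter ι) (v : ι → Lp ℝ 2 μ) (R : ℝ)
    (hv : ∀ i, ‖v i‖ ≤ R) :
    ∃ G : Lp ℝ 2 μ, ∀ u : Lp ℝ 2 μ,
      Tendsto (fun i => ∫ x, v i x * u x ∂μ) l (𝓝 (∫ x, G x * u x ∂μ)) := by
  let T : ι → WeakDual ℝ (Lp ℝ 2 μ) := fun i =>
    StrongDual.toWeakDual (InnerProductSpace.toDual ℝ (Lp ℝ 2 μ) (v i))
  have hK := WeakDual.isCompact_closedBall (𝕜 := ℝ) (E := Lp ℝ 2 μ) 0 R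
  obtain ⟨T₀, -, hT₀⟩ := hK.ultrafilter_le_nhds (l.map T) (by
    rw [le_principal_iff]
    refine Filter.mem_map.2 (Filter.univ_mem' fun i => ?_)
    simp only [T, mem_preimage]
    rw [mem_closedBall_zero_iff]
    exact ((InnerProductSpace.toDual ℝ (Lp ℝ 2 μ)).norm_map (v i)).le.trans (hv i))
  refine ⟨(InnerProductSpace.toDual ℝ (Lp ℝ 2 μ)).symm (WeakDual.toStrongDual T₀), fun u => ?_⟩
  have h1 : ∀ a b : Lp ℝ 2 μ, ∫ x, a x * b x ∂μ = inner ℝ a b := fun a b => by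
    rw [L2.inner_def]
    simp [mul_comm]
  simp only [h1]
  rw [InnerProductSpace.toDual_symm_apply]
  exact ((WeakDual.eval_continuous u).tendsto T₀).comp (show Tendsto T l (𝓝 T₀) from hT₀)

/-- Weak* compactness of balls of `L^∞` along ultrafilters. -/
theorem exists_weakStar_limit [SigmaFinite μ] (l : Ultrafilter ι) (F : ι → α → ℝ) (C : ℝ)
    (hm : ∀ i, AEStronglyMeasurable (F i) μ) (hb : ∀ i, ∀ᵐ x ∂μ, |F i x| ≤ C) :
    ∃ g : Lp ℝ ∞ μ, (∀ᵐ x ∂μ, |g x| ≤ C) ∧ ∀ h : α → ℝ, Integrable h μ →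
      Tendsto (fun i => ∫ x, F i x * h x ∂μ) l (𝓝 (∫ x, g x * h x ∂μ)) := by
  -- A strictly positive integrable weight `p`, with `w = √p` in `L²`, moves the bounded family into
  -- `L²` as `F i * w`. Its weak limit `G` there gives the candidate `g = G / w`.
  obtain ⟨p, hp0, hpm, hpi⟩ := exists_pos_lintegral_lt_of_sigmaFinite μ (ε := 1) one_ne_zero
  have hp0' : ∀ x, (0 : ℝ) < p x := fun x => by exact_mod_cast hp0 x
  have hpI : Integrable (fun x => (p x : ℝ)) μ := by
    refine ⟨hpm.coe_nnreal_real.aestronglyMeasurable, ?_⟩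
    simpa [HasFiniteIntegral, enorm_eq_nnnorm] using hpi.trans ENNReal.one_lt_top
  set w : α → ℝ := fun x => Real.sqrt (p x) with hw
  have hw0 : ∀ x, 0 < w x := fun x => Real.sqrt_pos.2 (hp0' x)
  have hww : ∀ x, w x * w x = p x := fun x => Real.mul_self_sqrt (hp0' x).le
  have hwm : AEStronglyMeasurable w μ :=
    hpm.coe_nnreal_real.sqrt.aestronglyMeasurable
  have hwL : MemLp w 2 μ := by
    rw [memLp_two_iff_integrable_sq hwm]
    simpa only [pow_two, hww] using hpI
  have hvL : ∀ i, MemLp (fun x => F i x * w x) 2 μ := fun i => by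
    refine hwL.of_le_mul (c := C) ((hm i).mul hwm) ?_
    filter_upwards [hb i] with x hx
    rw [norm_mul, Real.norm_eq_abs]
    gcongr
  obtain ⟨G, hG⟩ := exists_weak_limit_L2 l (fun i => (hvL i).toLp) (C * ‖hwL.toLp‖) (fun i => by
    refine Lp.norm_le_mul_norm_of_ae_le_mul ?_
    filter_upwards [hb i, (hvL i).coeFn_toLp, hwL.coeFn_toLp] with x hx h1 h2
    rw [h1, h2, norm_mul, Real.norm_eq_abs]
    gcongr)
  have hG' : ∀ u : α → ℝ, MemLp u 2 μ →
      Tendsto (fun i => ∫ x, F i x * w x * u x ∂μ) l (𝓝 (∫ x, G x * u x ∂μ)) := by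
    intro u hu
    have h1 : ∫ x, G x * u x ∂μ = ∫ x, G x * hu.toLp u x ∂μ := by
      refine integral_congr_ae ?_
      filter_upwards [hu.coeFn_toLp] with x hx
      rw [hx]
    rw [h1]
    refine (hG (hu.toLp u)).congr fun i => integral_congr_ae ?_
    filter_upwards [hu.coeFn_toLp, (hvL i).coeFn_toLp] with x hx hy
    rw [hx, hy]
  have hGm : AEStronglyMeasurable G μ := Lp.aestronglyMeasurable G
  have hGw : Integrable (fun x => G x * w x) μ := (Lp.memLp G).integrable_mul hwL
  -- Testing against `w` on `s` compares `G * w` with `± C * p` on every measurable set, hence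
  -- almost everywhere; as `p = w * w`, this bounds `G / w` by `C`.
  have hset : ∀ s, MeasurableSet s →
      Tendsto (fun i => ∫ x in s, F i x * p x ∂μ) l (𝓝 (∫ x in s, G x * w x ∂μ)) := by
    intro s hs
    have := hG' _ (hwL.indicator hs)
    have e : ∀ k : α → ℝ, ∫ x, k x * s.indicator w x ∂μ = ∫ x in s, k x * w x ∂μ := fun k => by
      rw [← integral_indicator hs]
      congr 1
      ext x
      by_cases hx : x ∈ s <;> simp [hx]
    simp only [e] at this
    simpa only [mul_assoc, hww] using this
  have hseti : ∀ s i, |∫ x in s, F i x * p x ∂μ| ≤ ∫ x in s, C * p x ∂μ := by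
    intro s i
    refine (abs_integral_mul_le (ae_restrict_of_ae (hb i)) hpI.integrableOn).trans ?_
    rw [integral_const_mul]
    simp
  have hle : (fun x => G x * w x) ≤ᵐ[μ] fun x => C * (p x : ℝ) :=
    ae_le_of_forall_setIntegral_le hGw (hpI.const_mul C) fun s hs _ =>
      le_of_tendsto' (hset s hs) fun i => (abs_le.1 (hseti s i)).2
  have hge : (fun x => -(C * (p x : ℝ))) ≤ᵐ[μ] fun x => G x * w x :=
    ae_le_of_forall_setIntegral_le (hpI.const_mul C).neg hGw fun s hs _ => by
      rw [integral_neg]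
      exact ge_of_tendsto' (hset s hs) fun i => (abs_le.1 (hseti s i)).1
  have hgb : ∀ᵐ x ∂μ, |G x / w x| ≤ C := by
    filter_upwards [hle, hge] with x h1 h2
    rw [← hww, ← mul_assoc] at h1 h2
    rw [abs_le, le_div_iff₀ (hw0 x), div_le_iff₀ (hw0 x)]
    refine ⟨le_of_mul_le_mul_right ?_ (hw0 x), le_of_mul_le_mul_right h1 (hw0 x)⟩
    linarith
  have hgL : MemLp (fun x => G x / w x) ∞ μ :=
    memLp_top_of_bound (hGm.div₀ hwm) C hgb
  have hgb' : ∀ᵐ x ∂μ, |hgL.toLp _ x| ≤ C := by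
    filter_upwards [hgb, hgL.coeFn_toLp] with x h1 h2
    rwa [h2]
  refine ⟨hgL.toLp, hgb', fun h hh => ?_⟩
  -- On `S n` one has `|h / w| ≤ n * w`, so the truncation of `h` divided by `w` is an admissible
  -- `L²` test function. The truncations converge to `h` in `L¹`, and the bound `C` makes the error
  -- uniform in `i`.
  let S : ℕ → Set α := fun n => {x | |h x| ≤ n * p x}
  have hS : ∀ n, NullMeasurableSet (S n) μ := fun n =>
    nullMeasurableSet_le hh.aestronglyMeasurable.norm.aemeasurable
      (hpm.coe_nnreal_real.const_mul _).aemeasurable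
  have hhn : ∀ n, Integrable ((S n).indicator h) μ := fun n => hh.indicator₀ (hS n)
  have htr : ∀ n, Tendsto (fun i => ∫ x, F i x * (S n).indicator h x ∂μ) l
      (𝓝 (∫ x, hgL.toLp _ x * (S n).indicator h x ∂μ)) := by
    intro n
    have hu : MemLp (fun x => (S n).indicator h x / w x) 2 μ := by
      refine hwL.of_le_mul (c := n)
        ((hhn n).aestronglyMeasurable.div₀ hwm) ?_
      refine .of_forall fun x => ?_
      rw [norm_div, Real.norm_of_nonneg (hw0 x).le, div_le_iff₀ (hw0 x), mul_assoc, hww]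
      by_cases hx : x ∈ S n
      · rw [indicator_of_mem hx]
        exact hx
      · simp only [hx, not_false_eq_true, indicator_of_notMem, norm_zero]
        positivity
    have e1 : ∫ x, hgL.toLp _ x * (S n).indicator h x ∂μ
        = ∫ x, G x * ((S n).indicator h x / w x) ∂μ := by
      refine integral_congr_ae ?_
      filter_upwards [hgL.coeFn_toLp] with x hx
      rw [hx]
      ring
    rw [e1]
    refine (hG' _ hu).congr fun i => integral_congr_ae (.of_forall fun x => ?_)
    have := (hw0 x).ne'
    field_simp
  have hδ : Tendsto (fun n => ∫ x, |h x - (S n).indicator h x| ∂μ) atTop (𝓝 0) := by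
    have : Tendsto (fun n => ∫ x, |h x - (S n).indicator h x| ∂μ) atTop
        (𝓝 (∫ _, (0 : ℝ) ∂μ)) := by
      refine tendsto_integral_of_dominated_convergence (fun x => |h x|)
        (fun n => (hh.sub (hhn n)).abs.aestronglyMeasurable) hh.abs ?_ ?_
      · refine fun n => .of_forall fun x => ?_
        by_cases hx : x ∈ S n <;> simp [hx]
      · refine .of_forall fun x => tendsto_const_nhds.congr' ?_
        obtain ⟨N, hN⟩ := exists_nat_ge (|h x| / p x)
        filter_upwards [eventually_ge_atTop N] with n hn
        have hx : x ∈ S n := by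
          have hn' : (N : ℝ) ≤ n := by exact_mod_cast hn
          exact (div_le_iff₀ (hp0' x)).1 (hN.trans hn')
        simp [hx]
    simpa using this
  have happ : ∀ (k : α → ℝ), AEStronglyMeasurable k μ → (∀ᵐ x ∂μ, |k x| ≤ C) → ∀ n,
      |∫ x, k x * h x ∂μ - ∫ x, k x * (S n).indicator h x ∂μ|
        ≤ C * ∫ x, |h x - (S n).indicator h x| ∂μ := by
    intro k hk hkb n
    rw [← integral_sub (integrable_bdd_mul hk hkb hh) (integrable_bdd_mul hk hkb (hhn n))]
    simp only [← mul_sub]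
    exact abs_integral_mul_le hkb (hh.sub (hhn n))
  rw [Metric.tendsto_nhds]
  intro ε hε
  have hδ' := hδ.const_mul C
  rw [mul_zero] at hδ'
  obtain ⟨n, hn⟩ := (hδ'.eventually_lt_const (show (0 : ℝ) < ε / 3 by linarith)).exists
  filter_upwards [Metric.tendsto_nhds.1 (htr n) (ε / 3) (by linarith)] with i hi
  have h1 := abs_le.1 (happ (F i) (hm i) (hb i) n)
  have h2 := abs_le.1 (happ _ (Lp.aestronglyMeasurable hgL.toLp) hgb' n)
  rw [Real.dist_eq, abs_lt] at hi ⊢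
  constructor <;> linarith [h1.1, h1.2, h2.1, h2.2, hi.1, hi.2]

end WeakStar

/-! ### The logarithmic primitive and the existence of `upperLogMean`. -/

theorem ae_abs_le_norm (f : Linf) : ∀ᵐ x ∂volume.restrict (Ici (1 : ℝ)), |f x| ≤ ‖f‖ := by
  filter_upwards [ae_le_eLpNormEssSup (f := f) (μ := volume.restrict (Ici (1 : ℝ)))] with x hx
  rw [Lp.norm_def, eLpNorm_exponent_top]
  have := ENNReal.toReal_mono (by simpa using Lp.eLpNorm_ne_top f) hx
  simpa using this

theorem ae_restrict_of_ae_Ici {p : ℝ → Prop} (h : ∀ᵐ x ∂volume.restrict (Ici (1 : ℝ)), p x)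
    {a b : ℝ} (ha : 1 ≤ a) (hb : 1 ≤ b) : ∀ᵐ x ∂volume.restrict (Ι a b), p x :=
  ae_restrict_of_ae_restrict_of_subset
    (fun _ hx => (le_min ha hb).trans (by simpa using hx.1.le)) h

theorem intervalIntegrable_inv_of_one_le {a b : ℝ} (ha : 1 ≤ a) (hb : 1 ≤ b) :
    IntervalIntegrable (fun t : ℝ => t⁻¹) volume a b :=
  intervalIntegral.intervalIntegrable_inv (fun x hx => by
    have := (le_min ha hb).trans hx.1
    linarith) continuousOn_id

theorem intervalIntegrable_div (f : Linf) {a b : ℝ} (ha : 1 ≤ a) (hb : 1 ≤ b) :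
    IntervalIntegrable (fun t => f t / t) volume a b := by
  refine ((intervalIntegrable_inv_of_one_le ha hb).const_mul ‖f‖).mono_fun
    ((Lp.stronglyMeasurable f).measurable.div measurable_id).aestronglyMeasurable ?_
  filter_upwards [ae_restrict_of_ae_Ici (ae_abs_le_norm f) ha hb] with x hx
  rw [div_eq_mul_inv, norm_mul, norm_mul, norm_norm, Real.norm_eq_abs (f x)]
  gcongr

/-- The primitive of `f t / t` in the logarithmic variable, extended by `0` to the negative
half-line. -/
noncomputable def logPrim (f : Linf) (u : ℝ) : ℝ := ∫ t in (1 : ℝ)..Real.exp (max u 0), f t / t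

theorem one_le_exp_max (u : ℝ) : 1 ≤ Real.exp (max u 0) := Real.one_le_exp (le_max_right _ _)

theorem logPrim_of_nonneg (f : Linf) {u : ℝ} (hu : 0 ≤ u) :
    logPrim f u = ∫ t in (1 : ℝ)..Real.exp u, f t / t := by
  rw [logPrim, max_eq_left hu]

@[simp]
theorem logPrim_zero (f : Linf) : logPrim f 0 = 0 := by
  simp [logPrim]

theorem logPrim_sub (f : Linf) (u v : ℝ) :
    logPrim f v - logPrim f u = ∫ t in Real.exp (max u 0)..Real.exp (max v 0), f t / t :=
  intervalIntegral.integral_interval_sub_left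
    (intervalIntegrable_div f le_rfl (one_le_exp_max v))
    (intervalIntegrable_div f le_rfl (one_le_exp_max u))

theorem logPrim_increment (f : Linf) {u X : ℝ} (hu : 0 ≤ u) (hX : 0 ≤ X) :
    logPrim f (u + X) - logPrim f u
      = ∫ t in Real.exp u..Real.exp X * Real.exp u, f t / t := by
  rw [logPrim_sub, max_eq_left hu, max_eq_left (add_nonneg hu hX), Real.exp_add, mul_comm]

/-- The integral of `dt / t` over `[e^u, e^v]` is `v - u`. Truncation at `0` does not increase
distances, so the bound holds on the whole line, as the increment lemmas require. -/
theorem lipschitzWith_logPrim (f : Linf) : LipschitzWith ‖f‖₊ (logPrim f) := by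
  have key : ∀ u v, u ≤ v → |logPrim f v - logPrim f u| ≤ ‖f‖ * |v - u| := by
    intro u v huv
    have hm : max u 0 ≤ max v 0 := max_le_max huv le_rfl
    have he : Real.exp (max u 0) ≤ Real.exp (max v 0) := Real.exp_le_exp.2 hm
    rw [logPrim_sub]
    have h1 := intervalIntegral.norm_integral_le_of_norm_le (μ := volume) he
      (f := fun t => f t / t) (g := fun t => ‖f‖ * t⁻¹) (by
        have := ae_restrict_of_ae_Ici (ae_abs_le_norm f) (one_le_exp_max u) (one_le_exp_max v)
        rw [uIoc_of_le he, ae_restrict_iff' measurableSet_Ioc] at this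
        filter_upwards [this] with x hx hx'
        have hx0 : 0 < x := (Real.exp_pos _).trans hx'.1
        rw [div_eq_mul_inv, norm_mul, norm_inv, Real.norm_eq_abs, Real.norm_of_nonneg hx0.le]
        gcongr
        exact hx hx')
      ((intervalIntegrable_inv_of_one_le (one_le_exp_max u) (one_le_exp_max v)).const_mul _)
    rw [intervalIntegral.integral_const_mul,
      integral_inv_of_pos (Real.exp_pos _) (Real.exp_pos _), ← Real.exp_sub, Real.log_exp] at h1
    refine h1.trans ?_
    gcongr
    exact (le_abs_self _).trans (abs_max_sub_max_le_abs v u 0)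
  refine LipschitzWith.of_dist_le_mul fun u v => ?_
  rw [Real.dist_eq, Real.dist_eq, coe_nnnorm]
  rcases le_total u v with h | h
  · rw [abs_sub_comm, abs_sub_comm u]
    exact key u v h
  · exact key v u h

theorem abs_logPrim_le (f : Linf) (u : ℝ) : |logPrim f u| ≤ ‖f‖ * |u| := by
  simpa using abs_increment_le (lipschitzWith_logPrim f) 0 u

theorem logPrim_add (f g : Linf) (u : ℝ) : logPrim (f + g) u = logPrim f u + logPrim g u := by
  rw [logPrim, logPrim, logPrim, ← intervalIntegral.integral_add
    (intervalIntegrable_div f le_rfl (one_le_exp_max u))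
    (intervalIntegrable_div g le_rfl (one_le_exp_max u))]
  refine intervalIntegral.integral_congr_ae_restrict ?_
  filter_upwards [ae_restrict_of_ae_Ici (Lp.coeFn_add f g) le_rfl (one_le_exp_max u)] with x hx
  rw [hx, Pi.add_apply, add_div]

theorem logPrim_smul (c : ℝ) (f : Linf) (u : ℝ) : logPrim (c • f) u = c * logPrim f u := by
  rw [logPrim, logPrim, ← intervalIntegral.integral_const_mul]
  refine intervalIntegral.integral_congr_ae_restrict ?_
  filter_upwards [ae_restrict_of_ae_Ici (Lp.coeFn_smul c f) le_rfl (one_le_exp_max u)] with x hx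
  rw [hx, Pi.smul_apply, smul_eq_mul, mul_div_assoc]

theorem logPrim_mono {f : Linf} (hf : 0 ≤ f) {u v : ℝ} (huv : u ≤ v) :
    logPrim f u ≤ logPrim f v := by
  rw [← sub_nonneg, logPrim_sub]
  have he : Real.exp (max u 0) ≤ Real.exp (max v 0) :=
    Real.exp_le_exp.2 (max_le_max huv le_rfl)
  refine intervalIntegral.integral_nonneg_of_ae_restrict he ?_
  have h0 : ∀ᵐ x ∂volume.restrict (Ici (1 : ℝ)), 0 ≤ f x := (Lp.coeFn_nonneg f).2 hf
  have h1 : ∀ᵐ x ∂volume.restrict (Ici (1 : ℝ)), x ∈ Ici (1 : ℝ) :=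
    ae_restrict_mem measurableSet_Ici
  refine ae_restrict_of_ae_restrict_of_subset (fun x hx => (one_le_exp_max u).trans hx.1) ?_
  filter_upwards [h0, h1] with x hx hx1
  exact div_nonneg hx (zero_le_one.trans hx1)

theorem logPrim_one {u : ℝ} (hu : 0 ≤ u) : logPrim oneLinf u = u := by
  have : ∫ t in (1 : ℝ)..Real.exp u, oneLinf t / t = ∫ t in (1 : ℝ)..Real.exp u, t⁻¹ := by
    refine intervalIntegral.integral_congr_ae_restrict ?_
    filter_upwards [ae_restrict_of_ae_Ici (MemLp.coeFn_toLp (memLp_top_const (1 : ℝ))) le_rfl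
      (Real.one_le_exp hu)] with x hx
    rw [oneLinf, hx, one_div]
  rw [logPrim_of_nonneg _ hu, this, integral_inv_of_pos one_pos (Real.exp_pos _), div_one,
    Real.log_exp]

theorem upperLogAverage_exp (f : Linf) {a : ℝ} (ha : 0 < a) :
    upperLogAverage f (Real.exp a) = shiftSup (logPrim f) a / a := by
  have hL := lipschitzWith_logPrim f
  have h1 : upperLogAverage f (Real.exp a)
      = limsup (fun u => (1 / a) * (logPrim f (u + a) - logPrim f u)) atTop := by
    rw [upperLogAverage, Real.log_exp]
    conv_lhs => rw [← Real.map_exp_atTop, ← limsup_comp]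
    refine limsup_congr ?_
    filter_upwards [eventually_ge_atTop (0 : ℝ)] with u hu
    rw [Function.comp, logPrim_increment f hu ha.le]
  have hmono : Monotone fun y : ℝ => (1 / a) * y := fun x y h => by
    dsimp only
    gcongr
  rw [h1, shiftSup, div_eq_inv_mul (limsup _ _), ← one_div]
  exact (hmono.map_limsup_of_continuousAt (F := atTop)
    (fun u => logPrim f (u + a) - logPrim f u)
    (continuous_const_mul _).continuousAt (increment_isBoundedUnder hL _ a)
    (increment_isBoundedUnder_ge hL _ a).isCoboundedUnder_flip).symm

theorem tendsto_upperLogAverage (f : Linf) :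
    Tendsto (upperLogAverage f) atTop (𝓝 (upperLogMean f)) := by
  obtain ⟨L, hL⟩ := exists_tendsto_shiftSup_div (lipschitzWith_logPrim f)
  refine tendsto_nhds_limUnder ⟨L, ?_⟩
  rw [← Real.map_exp_atTop, tendsto_map'_iff]
  refine hL.congr' ?_
  filter_upwards [eventually_gt_atTop 0] with a ha
  exact (upperLogAverage_exp f ha).symm

theorem tendsto_shiftSup_logPrim (f : Linf) :
    Tendsto (fun a => shiftSup (logPrim f) a / a) atTop (𝓝 (upperLogMean f)) := by
  refine ((tendsto_upperLogAverage f).comp Real.tendsto_exp_atTop).congr' ?_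
  filter_upwards [eventually_gt_atTop 0] with a ha
  exact upperLogAverage_exp f ha

/-! ### Weak* limits of dilates. -/

section DilateLimit

variable {ω : Ultrafilter ℝ}

/-- Dilation by `r ≥ 1` maps `[1, ∞)` into itself and pulls null sets back to null sets, so dilates
of a class in `L^∞` make sense. -/
theorem ae_dilate {p : ℝ → Prop} (h : ∀ᵐ x ∂volume.restrict (Ici (1 : ℝ)), p x) {r : ℝ}
    (hr : 1 ≤ r) : ∀ᵐ x ∂volume.restrict (Ici (1 : ℝ)), p (r * x) := by
  rw [ae_restrict_iff' measurableSet_Ici] at h ⊢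
  have hq : Measure.QuasiMeasurePreserving (fun x : ℝ => r * x) volume volume :=
    ⟨measurable_const_mul r, by
      rw [Real.map_volume_mul_left (by linarith)]
      exact Measure.smul_absolutelyContinuous⟩
  filter_upwards [hq.ae h] with x hx hx1
  exact hx (one_le_mul_of_one_le_of_one_le hr hx1)

theorem integrable_dilate_mul (f : Linf) {r : ℝ} (hr : 1 ≤ r) {h : ℝ → ℝ}
    (hh : IntegrableOn h (Ici 1)) :
    Integrable (fun x => f (r * x) * h x) (volume.restrict (Ici (1 : ℝ))) :=
  integrable_bdd_mul ((Lp.stronglyMeasurable f).comp_measurable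
    (measurable_const_mul r)).aestronglyMeasurable (ae_dilate (ae_abs_le_norm f) hr) hh

theorem eventually_one_le_map_exp (hω : (ω : Filter ℝ) ≤ atTop) :
    ∀ᶠ r in (ω.map Real.exp : Filter ℝ), 1 ≤ r := by
  rw [Ultrafilter.coe_map, eventually_map]
  filter_upwards [hω (eventually_ge_atTop 0)] with u hu
  exact Real.one_le_exp hu

theorem exists_isDilateLimit (hω : (ω : Filter ℝ) ≤ atTop) (f : Linf) :
    ∃ g : Linf, IsDilateLimit ω f g ∧ ‖g‖ ≤ ‖f‖ := by
  -- The compactness lemma needs a bound for every index, but the dilates are controlled only for `r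
  -- ≥ 1`; `max r 1` agrees with `r` eventually along `e^ω`.
  obtain ⟨g, hgb, hg⟩ := exists_weakStar_limit (μ := volume.restrict (Ici (1 : ℝ)))
    (ω.map Real.exp) (fun r x => f (max r 1 * x)) ‖f‖
    (fun r => ((Lp.stronglyMeasurable f).comp_measurable
      (measurable_const_mul _)).aestronglyMeasurable)
    (fun r => ae_dilate (ae_abs_le_norm f) (le_max_right _ _))
  refine ⟨g, fun h hh => (hg h hh).congr' ?_, ?_⟩
  · filter_upwards [eventually_one_le_map_exp hω] with r hr
    rw [max_eq_left hr]
  · rw [Lp.norm_def, eLpNorm_exponent_top]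
    exact ENNReal.toReal_le_of_le_ofReal (norm_nonneg f) (eLpNormEssSup_le_of_ae_bound hgb)

theorem IsDilateLimit.unique {f g g' : Linf} (h : IsDilateLimit ω f g)
    (h' : IsDilateLimit ω f g') : g = g' := by
  have hint : ∀ (k : Linf) s, (volume.restrict (Ici (1 : ℝ))) s < ∞ →
      IntegrableOn k s (volume.restrict (Ici (1 : ℝ))) := fun k s hs =>
    Measure.integrableOn_of_bounded hs.ne (Lp.aestronglyMeasurable k)
      (ae_restrict_of_ae (ae_abs_le_norm k))
  refine Lp.ext (ae_eq_of_forall_setIntegral_eq_of_sigmaFinite (fun s _ hs => hint g s hs)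
    (fun s _ hs => hint g' s hs) fun s hs hμs => ?_)
  have hi : IntegrableOn (s.indicator fun _ => (1 : ℝ)) (Ici 1) :=
    (integrable_indicator_iff hs).2 (integrableOn_const hμs.ne)
  have := tendsto_nhds_unique (h _ hi) (h' _ hi)
  have e : ∀ k : Linf, ∫ x in Ici (1 : ℝ), k x * s.indicator (fun _ => (1 : ℝ)) x
      = ∫ x in s, k x ∂(volume.restrict (Ici (1 : ℝ))) := fun k => by
    rw [← integral_indicator hs]
    congr 1
    ext x
    by_cases hx : x ∈ s <;> simp [hx]
  rwa [e, e] at this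

theorem IsDilateLimit.add (hω : (ω : Filter ℝ) ≤ atTop) {f₁ f₂ g₁ g₂ : Linf}
    (h₁ : IsDilateLimit ω f₁ g₁) (h₂ : IsDilateLimit ω f₂ g₂) :
    IsDilateLimit ω (f₁ + f₂) (g₁ + g₂) := by
  intro h hh
  have e : ∫ x in Ici (1 : ℝ), (g₁ + g₂ : Linf) x * h x
      = (∫ x in Ici (1 : ℝ), g₁ x * h x) + ∫ x in Ici (1 : ℝ), g₂ x * h x := by
    rw [← integral_add
      (integrable_bdd_mul (Lp.aestronglyMeasurable g₁) (ae_abs_le_norm g₁) hh)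
      (integrable_bdd_mul (Lp.aestronglyMeasurable g₂) (ae_abs_le_norm g₂) hh)]
    refine integral_congr_ae ?_
    filter_upwards [Lp.coeFn_add g₁ g₂] with x hx
    rw [hx, Pi.add_apply, add_mul]
  rw [e]
  refine ((h₁ h hh).add (h₂ h hh)).congr' ?_
  filter_upwards [eventually_one_le_map_exp hω] with r hr
  rw [← integral_add (integrable_dilate_mul f₁ hr hh) (integrable_dilate_mul f₂ hr hh)]
  refine integral_congr_ae ?_
  filter_upwards [ae_dilate (Lp.coeFn_add f₁ f₂) hr] with x hx
  rw [hx, Pi.add_apply, add_mul]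

theorem IsDilateLimit.smul (hω : (ω : Filter ℝ) ≤ atTop) (c : ℝ) {f g : Linf}
    (h₁ : IsDilateLimit ω f g) : IsDilateLimit ω (c • f) (c • g) := by
  intro h hh
  have e : ∫ x in Ici (1 : ℝ), (c • g : Linf) x * h x = c * ∫ x in Ici (1 : ℝ), g x * h x := by
    rw [← integral_const_mul]
    refine integral_congr_ae ?_
    filter_upwards [Lp.coeFn_smul c g] with x hx
    rw [hx, Pi.smul_apply, smul_eq_mul, mul_assoc]
  rw [e]
  refine ((h₁ h hh).const_mul c).congr' ?_
  filter_upwards [eventually_one_le_map_exp hω] with r hr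
  rw [← integral_const_mul]
  refine integral_congr_ae ?_
  filter_upwards [ae_dilate (Lp.coeFn_smul c f) hr] with x hx
  rw [hx, Pi.smul_apply, smul_eq_mul, mul_assoc]

/-- The test function `1/x` on `(1, e^X]` and the substitution `t = e^u x` turn the pairing with the
dilate by `e^u` into an increment of `logPrim f`. All later estimates on `g` from `f` pass through
this. -/
theorem IsDilateLimit.tendsto_logPrim (hω : (ω : Filter ℝ) ≤ atTop) {f g : Linf}
    (hg : IsDilateLimit ω f g) {X : ℝ} (hX : 0 ≤ X) :
    Tendsto (fun u => logPrim f (u + X) - logPrim f u) ω (𝓝 (logPrim g X)) := by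
  have he : 1 ≤ Real.exp X := Real.one_le_exp hX
  set h : ℝ → ℝ := (Ioc 1 (Real.exp X)).indicator (fun x => x⁻¹) with hh
  have hint : IntegrableOn h (Ici 1) := by
    refine Integrable.integrableOn ((integrable_indicator_iff measurableSet_Ioc).2 ?_)
    exact (intervalIntegrable_iff_integrableOn_Ioc_of_le he).1 (intervalIntegrable_inv_of_one_le le_rfl he)
  have e : ∀ k : ℝ → ℝ, ∫ x in Ici (1 : ℝ), k x * h x = ∫ x in (1 : ℝ)..Real.exp X, k x / x := by
    intro k
    have : (fun x => k x * h x) = (Ioc 1 (Real.exp X)).indicator (fun x => k x / x) := by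
      ext x
      by_cases hx : x ∈ Ioc 1 (Real.exp X) <;> simp [hh, hx, div_eq_mul_inv]
    rw [this, setIntegral_indicator measurableSet_Ioc, intervalIntegral.integral_of_le he,
      inter_eq_right.2 fun x hx => hx.1.le]
  have := hg h hint
  rw [e, ← logPrim_of_nonneg g hX, Ultrafilter.coe_map, tendsto_map'_iff] at this
  refine this.congr' ?_
  filter_upwards [hω (eventually_ge_atTop 0)] with u hu
  rw [Function.comp, e, logPrim_increment f hu hX]
  have hm := intervalIntegral.mul_integral_comp_mul_left (a := 1) (b := Real.exp X)
    (f := fun t => f t / t) (Real.exp u)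
  rw [mul_one, mul_comm (Real.exp u) (Real.exp X)] at hm
  rw [← hm, ← intervalIntegral.integral_const_mul]
  congr 1
  ext x
  rw [mul_div_assoc', mul_div_mul_left _ _ (Real.exp_pos u).ne']

end DilateLimit

/-! ### Ultrafilters at infinity and the functionals `ψ_ω^𝒰`. -/

theorem le_atTop_of_mem_OmegaStar {ω : Ultrafilter ℝ} (h : ω ∈ OmegaStar) :
    (ω : Filter ℝ) ≤ atTop := by
  obtain ⟨η, hη, t, -, rfl⟩ := h
  have h1 : (η : Filter ℕ) ≤ atTop := by
    rw [← Nat.cofinite_eq_atTop]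
    exact η.le_cofinite_or_eq_pure.resolve_right fun ⟨n, hn⟩ => hη n hn
  exact (tendsto_atTop_add_const_right atTop t tendsto_natCast_atTop_atTop).mono_left h1

theorem mem_UnboundedUltrafilters_iff {𝒰 : Ultrafilter ℝ} :
    𝒰 ∈ UnboundedUltrafilters ↔ (𝒰 : Filter ℝ) ≤ atTop := by
  constructor
  · rintro ⟨h1, h2⟩
    refine le_iInf fun b => le_principal_iff.2 ?_
    by_contra hb
    refine h2 _ (inter_mem h1 (Ultrafilter.compl_mem_iff_notMem.2 hb)) ?_
    refine (Metric.isBounded_Icc 1 b).subset fun x hx => ⟨hx.1, (lt_of_not_ge fun h => hx.2 h).le⟩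
  · refine fun h => ⟨h (Ici_mem_atTop 1), fun A hA hb => ?_⟩
    obtain ⟨b, hb⟩ := hb.bddAbove
    obtain ⟨x, hx, hx'⟩ := 𝒰.nonempty_of_mem (inter_mem hA (h (Ioi_mem_atTop b)))
    exact absurd (hb hx) (not_le.2 hx')

section Functional

variable {ω 𝒰 : Ultrafilter ℝ}

theorem tendsto_logAverage_iff (h𝒰 : (𝒰 : Filter ℝ) ≤ atTop) (g : Linf) (y : ℝ) :
    Tendsto (fun x : ℝ => (1 / Real.log x) * ∫ t in (1 : ℝ)..x, g t / t) (𝒰.map Real.exp) (𝓝 y)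
      ↔ Tendsto (fun u => logPrim g u / u) 𝒰 (𝓝 y) := by
  rw [Ultrafilter.coe_map, tendsto_map'_iff]
  refine tendsto_congr' ?_
  filter_upwards [h𝒰 (eventually_ge_atTop 0)] with u hu
  rw [Function.comp, Real.log_exp, logPrim_of_nonneg g hu, one_div_mul_eq_div]

theorem exists_tendsto_logPrim_div (𝒰 : Ultrafilter ℝ) (g : Linf) :
    ∃ y, |y| ≤ ‖g‖ ∧ Tendsto (fun u => logPrim g u / u) 𝒰 (𝓝 y) := by
  obtain ⟨y, hy, hle⟩ := (isCompact_Icc (a := -‖g‖) (b := ‖g‖)).ultrafilter_le_nhds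
    (𝒰.map fun u => logPrim g u / u) (by
      rw [le_principal_iff]
      refine Filter.mem_map.2 (Filter.univ_mem' fun u => ?_)
      rw [mem_preimage, mem_Icc, ← abs_le, abs_div]
      exact div_le_of_le_mul₀ (abs_nonneg u) (norm_nonneg g) (abs_logPrim_le g u))
  exact ⟨y, abs_le.2 hy, hle⟩

theorem IsPsi.exists_tendsto (h𝒰 : (𝒰 : Filter ℝ) ≤ atTop) {ψ : WeakDual ℝ Linf}
    (hψ : IsPsi ω 𝒰 ψ) (f : Linf) : ∃ g : Linf, IsDilateLimit ω f g ∧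
      Tendsto (fun u => logPrim g u / u) 𝒰 (𝓝 (ψ f)) := by
  obtain ⟨g, hg, h⟩ := hψ f
  exact ⟨g, hg, (tendsto_logAverage_iff h𝒰 g _).1 h⟩

/-- Uniqueness of dilate limits makes `f ↦ g` linear, and the bounds `|y| ≤ ‖g‖ ≤ ‖f‖` give
continuity. -/
theorem exists_isPsi (hω : (ω : Filter ℝ) ≤ atTop) (h𝒰 : (𝒰 : Filter ℝ) ≤ atTop) :
    ∃ ψ : WeakDual ℝ Linf, IsPsi ω 𝒰 ψ := by
  have hex : ∀ f : Linf, ∃ (y : ℝ) (g : Linf), IsDilateLimit ω f g ∧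
      Tendsto (fun u => logPrim g u / u) 𝒰 (𝓝 y) ∧ |y| ≤ ‖f‖ := by
    intro f
    obtain ⟨g, hg, hgn⟩ := exists_isDilateLimit hω f
    obtain ⟨y, hy, h⟩ := exists_tendsto_logPrim_div 𝒰 g
    exact ⟨y, g, hg, h, hy.trans hgn⟩
  choose m g hg hm hb using hex
  let T : Linf →ₗ[ℝ] ℝ :=
    { toFun := m
      map_add' := fun f₁ f₂ => by
        have e := (hg (f₁ + f₂)).unique ((hg f₁).add hω (hg f₂))
        refine tendsto_nhds_unique (hm (f₁ + f₂)) (((hm f₁).add (hm f₂)).congr fun u => ?_)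
        rw [e, logPrim_add, add_div]
      map_smul' := fun c f => by
        have e := (hg (c • f)).unique ((hg f).smul hω c)
        refine tendsto_nhds_unique (hm (c • f)) (((hm f).const_mul c).congr fun u => ?_)
        rw [e, logPrim_smul, mul_div_assoc] }
  let ψ : StrongDual ℝ Linf := T.mkContinuous 1 fun f => by
    rw [one_mul]
    exact hb f
  exact ⟨StrongDual.toWeakDual ψ, fun f => ⟨g f, hg f, (tendsto_logAverage_iff h𝒰 _ _).2 (hm f)⟩⟩

theorem IsPsi.unique {ψ ψ' : WeakDual ℝ Linf} (h : IsPsi ω 𝒰 ψ) (h' : IsPsi ω 𝒰 ψ') :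
    ψ = ψ' := by
  refine DFunLike.ext _ _ fun f => ?_
  obtain ⟨g, hg, ht⟩ := h f
  obtain ⟨g', hg', ht'⟩ := h' f
  obtain rfl := hg.unique hg'
  exact tendsto_nhds_unique ht ht'

theorem IsDilateLimit.logPrim_le_shiftSup (hω : (ω : Filter ℝ) ≤ atTop) {f g : Linf}
    (hg : IsDilateLimit ω f g) {X : ℝ} (hX : 0 ≤ X) : logPrim g X ≤ shiftSup (logPrim f) X := by
  refine le_of_forall_pos_le_add fun ε hε => le_of_tendsto (hg.tendsto_logPrim hω hX) ?_
  have := eventually_increment_lt (lipschitzWith_logPrim f)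
    (lt_add_of_pos_right (shiftSup (logPrim f) X) hε)
  filter_upwards [hω this] with u hu using hu.le

theorem IsPsi.mem_L1 (hω : (ω : Filter ℝ) ≤ atTop) (h𝒰 : (𝒰 : Filter ℝ) ≤ atTop)
    {ψ : WeakDual ℝ Linf} (hψ : IsPsi ω 𝒰 ψ) : ψ ∈ L1 := by
  refine ⟨⟨fun f hf => ?_, ?_⟩, fun f => ?_⟩
  · obtain ⟨g, hg, ht⟩ := hψ.exists_tendsto h𝒰 f
    refine ge_of_tendsto ht ?_
    filter_upwards [h𝒰 (eventually_ge_atTop 0)] with X hX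
    refine div_nonneg (ge_of_tendsto' (hg.tendsto_logPrim hω hX) fun u => ?_) hX
    exact sub_nonneg.2 (logPrim_mono hf (le_add_of_nonneg_right hX))
  · obtain ⟨g, hg, ht⟩ := hψ.exists_tendsto h𝒰 oneLinf
    refine tendsto_nhds_unique ht (tendsto_const_nhds.congr' ?_)
    filter_upwards [h𝒰 (eventually_gt_atTop 0)] with X hX
    have : logPrim g X = X := by
      refine tendsto_nhds_unique (hg.tendsto_logPrim hω hX.le) (tendsto_const_nhds.congr' ?_)
      filter_upwards [hω (eventually_ge_atTop 0)] with u hu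
      rw [logPrim_one hu, logPrim_one (add_nonneg hu hX.le), add_sub_cancel_left]
    rw [this, div_self hX.ne']
  · obtain ⟨g, hg, ht⟩ := hψ.exists_tendsto h𝒰 f
    refine le_of_tendsto_of_tendsto ht ((tendsto_shiftSup_logPrim f).mono_left h𝒰) ?_
    filter_upwards [h𝒰 (eventually_gt_atTop 0)] with X hX
    exact div_le_div_of_nonneg_right (hg.logPrim_le_shiftSup hω hX.le) hX.le

end Functional

/-! ### The closed convex hull of `P`. -/

theorem convex_L1 : Convex ℝ L1 := by
  rintro ψ ⟨⟨hψ0, hψ1⟩, hψ⟩ φ ⟨⟨hφ0, hφ1⟩, hφ⟩ a b ha hb hab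
  have e : ∀ f : Linf, (a • ψ + b • φ) f = a * ψ f + b * φ f := fun f => rfl
  refine ⟨⟨fun f hf => ?_, ?_⟩, fun f => ?_⟩
  · rw [e]
    exact add_nonneg (mul_nonneg ha (hψ0 f hf)) (mul_nonneg hb (hφ0 f hf))
  · rw [e, hψ1, hφ1, mul_one, mul_one, hab]
  · rw [e]
    calc a * ψ f + b * φ f ≤ a * upperLogMean f + b * upperLogMean f := by
          gcongr
          exacts [hψ f, hφ f]
      _ = upperLogMean f := by rw [← add_mul, hab, one_mul]

theorem isClosed_L1 : IsClosed L1 := by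
  have h : L1 = (⋂ f : Linf, ⋂ _ : 0 ≤ f, {ψ : WeakDual ℝ Linf | 0 ≤ ψ f})
      ∩ {ψ | ψ oneLinf = 1} ∩ ⋂ f : Linf, {ψ | ψ f ≤ upperLogMean f} := by
    ext ψ
    simp [L1, IsMean]
  rw [h]
  refine ((isClosed_iInter fun f => isClosed_iInter fun _ => ?_).inter ?_).inter
    (isClosed_iInter fun f => ?_)
  · exact isClosed_le continuous_const (WeakDual.eval_continuous f)
  · exact isClosed_eq (WeakDual.eval_continuous _) continuous_const
  · exact isClosed_le (WeakDual.eval_continuous f) continuous_const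

/-- Every value of `upperLogMean` is attained by some `ψ_ω^𝒰`. -/
theorem exists_mem_P_upperLogMean_le (f : Linf) : ∃ ψ ∈ P, upperLogMean f ≤ ψ f := by
  set L := upperLogMean f with hLdef
  -- Diagonal choice: the position, the admissible length and the precision all improve with `j`.
  have hstart : ∀ j : ℕ, ∃ n : ℕ, j ≤ n ∧ ∀ k : ℕ, 1 ≤ k → k ≤ j →
      (L - 1 / ((j : ℝ) + 1)) * k ≤ logPrim f (n + k) - logPrim f n := fun j =>
    exists_nat_forall_increment_ge (lipschitzWith_logPrim f) (tendsto_shiftSup_logPrim f)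
      (by positivity) j j
  choose n hn hinc using hstart
  have hntop : Tendsto n atTop atTop := tendsto_atTop_mono hn tendsto_id
  have hhyp : (hyperfilter ℕ : Filter ℕ) ≤ atTop := Nat.hyperfilter_le_atTop
  set ω : Ultrafilter ℝ := ((hyperfilter ℕ).map n).map (fun n : ℕ => (n : ℝ) + 0) with hω
  have hωmem : ω ∈ OmegaStar := by
    refine ⟨(hyperfilter ℕ).map n, fun m hm => ?_, 0, ⟨le_rfl, zero_le_one⟩, rfl⟩
    have h1 : Ioi m ∈ (hyperfilter ℕ).map n := (hntop.mono_left hhyp) (Ioi_mem_atTop m)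
    rw [hm, Ultrafilter.mem_pure] at h1
    exact lt_irrefl m h1
  have hωtop := le_atTop_of_mem_OmegaStar hωmem
  -- Any ultrafilter at infinity serves: the lower bound on `logPrim g X / X` below holds for all
  -- large `X`.
  set 𝒰 : Ultrafilter ℝ := Ultrafilter.of atTop
  have h𝒰 : (𝒰 : Filter ℝ) ≤ atTop := Ultrafilter.of_le atTop
  obtain ⟨ψ, hψ⟩ := exists_isPsi hωtop h𝒰
  refine ⟨ψ, ⟨ω, hωmem, 𝒰, mem_UnboundedUltrafilters_iff.2 h𝒰, hψ⟩, ?_⟩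
  obtain ⟨g, hg, ht⟩ := hψ.exists_tendsto h𝒰 f
  -- A fixed length `k` is admissible at all `n j` with `j ≥ k`, hence almost everywhere for the
  -- hyperfilter, and the defect `1 / (j + 1)` vanishes in the limit.
  have hnat : ∀ k : ℕ, L * k ≤ logPrim g k := by
    intro k
    rcases Nat.eq_zero_or_pos k with rfl | hk
    · simp
    have h1 := hg.tendsto_logPrim hωtop (Nat.cast_nonneg (α := ℝ) k)
    rw [hω, Ultrafilter.coe_map, Ultrafilter.coe_map, tendsto_map'_iff, tendsto_map'_iff] at h1
    have h2 : Tendsto (fun j : ℕ => (L - 1 / ((j : ℝ) + 1)) * k) (hyperfilter ℕ)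
        (𝓝 ((L - 0) * k)) :=
      ((tendsto_const_nhds.sub tendsto_one_div_add_atTop_nhds_zero_nat).mul_const _).mono_left
        hhyp
    rw [sub_zero] at h2
    refine le_of_tendsto_of_tendsto h2 h1 ?_
    filter_upwards [hhyp (eventually_ge_atTop k)] with j hj
    simpa using hinc j k hk hj
  have hlow : Tendsto (fun X : ℝ => L * (⌊X⌋₊ / X) - ‖g‖ / X) atTop (𝓝 (L * 1 - 0)) :=
    ((tendsto_nat_floor_div_atTop (R := ℝ)).const_mul L).sub
      (tendsto_const_nhds.div_atTop tendsto_id)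
  rw [mul_one, sub_zero] at hlow
  refine le_of_tendsto_of_tendsto (hlow.mono_left h𝒰) ht ?_
  filter_upwards [h𝒰 (eventually_gt_atTop 0)] with X hX
  rw [← mul_div_assoc, ← sub_div]
  refine div_le_div_of_nonneg_right ?_ hX.le
  have hd : |X - ⌊X⌋₊| ≤ 1 :=
    abs_le.2 ⟨by linarith [Nat.floor_le hX.le], by linarith [Nat.lt_floor_add_one X]⟩
  have h3 := (abs_le.1 (abs_increment_le (lipschitzWith_logPrim g) ⌊X⌋₊ (X - ⌊X⌋₊))).1
  rw [add_sub_cancel, coe_nnnorm] at h3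
  have h4 := mul_le_mul_of_nonneg_left hd (norm_nonneg g)
  linarith [hnat ⌊X⌋₊]

/-- A weak* closed convex set contains every functional which is dominated, at each point, by one
of its elements. -/
theorem mem_of_forall_exists_le {E : Type*} [NormedAddCommGroup E] [NormedSpace ℝ E]
    {K : Set (WeakDual ℝ E)} (hK : Convex ℝ K) (hKc : IsClosed K) {ψ : WeakDual ℝ E}
    (h : ∀ f : E, ∃ φ ∈ K, ψ f ≤ φ f) : ψ ∈ K := by
  by_contra hψ
  have : LocallyConvexSpace ℝ (WeakDual ℝ E) :=
    inferInstanceAs (LocallyConvexSpace ℝ (WeakBilin (topDualPairing ℝ E)))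
  obtain ⟨T, c, hT, hc⟩ := geometric_hahn_banach_closed_point hK hKc hψ
  -- The separating functional is weak* continuous, hence evaluation at some `f`; at this `f` the
  -- domination hypothesis contradicts strict separation.
  obtain ⟨f, hf⟩ := LinearMap.dualEmbedding_surjective (topDualPairing ℝ E) T
  have e : ∀ φ : WeakDual ℝ E, T φ = φ f := fun φ => by
    rw [← hf]
    rfl
  obtain ⟨φ, hφ, hle⟩ := h f
  have := hT φ hφ
  rw [e] at this hc
  linarith

theorem L1_eq_closedConvexHull_P : L1 = closedConvexHull ℝ P := by
  refine Subset.antisymm (fun ψ hψ => ?_) (closedConvexHull_min ?_ convex_L1 isClosed_L1)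
  · refine mem_of_forall_exists_le convex_closedConvexHull isClosed_closedConvexHull fun f => ?_
    obtain ⟨φ, hφ, hle⟩ := exists_mem_P_upperLogMean_le f
    exact ⟨φ, subset_closedConvexHull hφ, (hψ.2 f).trans hle⟩
  · rintro ψ ⟨ω, hω, 𝒰, h𝒰, hψ⟩
    exact hψ.mem_L1 (le_atTop_of_mem_OmegaStar hω) (mem_UnboundedUltrafilters_iff.1 h𝒰)

end LogMeans

/-- The limits entering the definitions exist and are unique, and the class `L1` is the weak*
closed convex hull of the functionals `ψ_ω^𝒰`. -/
theorem theorem4p9 :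
    (∀ f : LogMeans.Linf,
      Tendsto (LogMeans.upperLogAverage f) atTop (𝓝 (LogMeans.upperLogMean f))) ∧
    (∀ ω ∈ LogMeans.OmegaStar, ∀ f : LogMeans.Linf,
      ∃! g : LogMeans.Linf, LogMeans.IsDilateLimit ω f g) ∧
    (∀ ω ∈ LogMeans.OmegaStar, ∀ 𝒰 ∈ LogMeans.UnboundedUltrafilters,
      ∃! ψ : WeakDual ℝ LogMeans.Linf, LogMeans.IsPsi ω 𝒰 ψ) ∧
    LogMeans.L1 = closedConvexHull ℝ LogMeans.P := by
  refine ⟨LogMeans.tendsto_upperLogAverage, fun ω hω f => ?_, fun ω hω 𝒰 h𝒰 => ?_,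
    LogMeans.L1_eq_closedConvexHull_P⟩
  · obtain ⟨g, hg, -⟩ := LogMeans.exists_isDilateLimit (LogMeans.le_atTop_of_mem_OmegaStar hω) f
    exact ⟨g, hg, fun g' hg' => hg'.unique hg⟩
  · obtain ⟨ψ, hψ⟩ := LogMeans.exists_isPsi (LogMeans.le_atTop_of_mem_OmegaStar hω)
      (LogMeans.mem_UnboundedUltrafilters_iff.1 h𝒰)
    exact ⟨ψ, hψ, fun ψ' hψ' => hψ'.unique hψ⟩
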